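/- Let $\mathbb H$ be the real quaternions and $\mathbb M=\mathbb C\otimes_{\mathbb R}\mathbb H=\mathbb H+i\mathbb H$ its complexification (the unit $i$ of $\mathbb C$ commutes with $\mathbb H$), a complex $C^*$-algebra with the conjugation $\overline{b+ic}=b-ic$ for $b,c\in\mathbb H$. For $q\in\mathbb H$ let $\sigma(q)\subset\mathbb C$ be the spectrum of $q$ in $\mathbb M$, let $s_\pm(q)=\Re q\pm i\|\Im q\|$, and for $q\notin\mathbb R$ let $\mathfrak s_q=\Im q/\|\Im q\|$ and $\iota_\pm(\mathfrak s_q)=\tfrac12(1\mp i\,\mathfrak s_q)\in\mathbb M$. For $S\subset\mathbb C$ put $S_{\mathbb H}=\{q\in\mathbb H:\sigma(q)\subset S\}$. A Cauchy domain in an open set $U\subset\mathbb C$ is a bounded (not necessarily connected) open set $\Delta$ with $\overline\Delta\subset U$ whose boundary consists of finitely many piecewise smooth closed curves, positively oriented, i.e. with total winding number $1$ about each point of $\Delta$ and $0$ about each point of $\mathbb C\setminus\overline\Delta$. Let $U\subset\mathbb C$ be open and conjugate symmetric ($z\in U\iff\bar z\in U$), and let $F:U\to\mathbb M$ be analytic.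 Then for every $q\in U_{\mathbb H}$ there is a Cauchy domain in $U$ containing $\sigma(q)$, and the integral $$C[F](q)=\frac1{2\pi i}\int_\Gamma F(\zeta)(\zeta-q)^{-1}\,d\zeta ,$$ where $\Gamma$ is the boundary of such a domain and the inverse is taken in $\mathbb M$, does not depend on the choice of the domain. Moreover, for every $q\in U_{\mathbb H}$, $$C[F](q)=F_{\mathbb H}(q):=F(s_+(q))\,\iota_+(\mathfrak s_q)+F(s_-(q))\,\iota_-(\mathfrak s_q),$$ where for $q\in\mathbb R$ the right-hand side is understood as $F(q)$. Finally, $C[F](q)\in\mathbb H$ for all $q\in U_{\mathbb H}$ if and only if $F$ is a stem function, i.e. $F(\bar\lambda)=\overline{F(\lambda)}$ for all $\lambda\in U$. -/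

import Mathlib

open scoped Quaternion

noncomputable section

namespace QCauchy

/-! ### The complexification of Hamilton's algebra -/

/-- The complex algebra `𝕄 = ℂ ⊗_ℝ ℍ = ℍ + iℍ`, realised as the quaternion algebra
with complex coefficients.  The quaternionic units are `⟨0, 1, 0, 0⟩`, `⟨0, 0, 1, 0⟩`, `⟨0, 0, 0, 1⟩`; the unit
`i` of `ℂ` acts by scalars, so it commutes with them.  The inclusion `ℂ ⊆ 𝕄` is `algebraMap`.  See
`eq_ofQuaternion_add_smul` and `ofQuaternion_add_smul_inj` for the decomposition `ℍ + iℍ`. -/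
abbrev M : Type := ℍ[ℂ,-1,-1]

/-- The inclusion `ℍ ⊆ 𝕄`, as a homomorphism of real algebras. -/
def ofQuaternion : ℍ[ℝ] →ₐ[ℝ] M where
  toFun q := ⟨q.re, q.imI, q.imJ, q.imK⟩
  map_one' := by ext <;> simp
  map_mul' a b := by ext <;> simp <;> ring
  map_zero' := by ext <;> simp
  map_add' a b := by ext <;> simp
  commutes' r := rfl

@[simp] theorem re_ofQuaternion (q : ℍ[ℝ]) : (ofQuaternion q).re = q.re := rfl
@[simp] theorem imI_ofQuaternion (q : ℍ[ℝ]) : (ofQuaternion q).imI = q.imI := rfl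
@[simp] theorem imJ_ofQuaternion (q : ℍ[ℝ]) : (ofQuaternion q).imJ = q.imJ := rfl
@[simp] theorem imK_ofQuaternion (q : ℍ[ℝ]) : (ofQuaternion q).imK = q.imK := rfl

/-- The elements of `𝕄` that are quaternions. -/
def IsQuaternion (a : M) : Prop := a ∈ Set.range ofQuaternion

/-- The conjugation `b + i c ↦ b - i c` of `𝕄` (`b, c ∈ ℍ`): complex conjugation of the four
coefficients. -/
def conjM (a : M) : M :=
  ⟨starRingEnd ℂ a.re, starRingEnd ℂ a.imI, starRingEnd ℂ a.imJ, starRingEnd ℂ a.imK⟩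

theorem eq_ofQuaternion_add_smul (a : M) :
    a = ofQuaternion ⟨a.re.re, a.imI.re, a.imJ.re, a.imK.re⟩
      + Complex.I • ofQuaternion ⟨a.re.im, a.imI.im, a.imJ.im, a.imK.im⟩ := by
  have key : ∀ z : ℂ, z = (z.re : ℂ) + Complex.I * (z.im : ℂ) := fun z => by
    rw [mul_comm]; exact (Complex.re_add_im z).symm
  exact QuaternionAlgebra.ext (key _) (key _) (key _) (key _)

theorem conjM_ofQuaternion_add_smul (b c : ℍ[ℝ]) :
    conjM (ofQuaternion b + Complex.I • ofQuaternion c)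
      = ofQuaternion b - Complex.I • ofQuaternion c := by
  ext <;> simp [conjM, sub_eq_add_neg]

theorem ofQuaternion_add_smul_inj {b c b' c' : ℍ[ℝ]}
    (h : ofQuaternion b + Complex.I • ofQuaternion c
      = ofQuaternion b' + Complex.I • ofQuaternion c') : b = b' ∧ c = c' := by
  have h0 := congrArg QuaternionAlgebra.re h
  have h1 := congrArg QuaternionAlgebra.imI h
  have h2 := congrArg QuaternionAlgebra.imJ h
  have h3 := congrArg QuaternionAlgebra.imK h
  simp [Complex.ext_iff] at h0 h1 h2 h3
  exact ⟨Quaternion.ext _ _ h0.1 h1.1 h2.1 h3.1, Quaternion.ext _ _ h0.2 h1.2 h2.2 h3.2⟩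

/-! ### The norm of `𝕄` -/

/-- The matrices representing the quaternionic units. -/
def matrixBasis : QuaternionAlgebra.Basis (Matrix (Fin 2) (Fin 2) ℂ) (-1 : ℂ) 0 (-1) where
  i := !![Complex.I, 0; 0, -Complex.I]
  j := !![0, 1; -1, 0]
  k := !![0, Complex.I; Complex.I, 0]
  i_mul_i := by ext a b; fin_cases a <;> fin_cases b <;> simp
  j_mul_j := by ext a b; fin_cases a <;> fin_cases b <;> simp
  i_mul_j := by ext a b; fin_cases a <;> fin_cases b <;> simp
  j_mul_i := by ext a b; fin_cases a <;> fin_cases b <;> simp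

/-- The standard matrix representation of `𝕄` on `ℂ²`. -/
def toMatrix : M →ₐ[ℂ] Matrix (Fin 2) (Fin 2) ℂ := QuaternionAlgebra.lift matrixBasis

theorem toMatrix_apply (a : M) :
    toMatrix a = !![a.re + Complex.I * a.imI, a.imJ + Complex.I * a.imK;
      -a.imJ + Complex.I * a.imK, a.re - Complex.I * a.imI] := by
  ext x y
  fin_cases x <;> fin_cases y <;>
    simp [toMatrix, matrixBasis, QuaternionAlgebra.Basis.lift, Matrix.algebraMap_matrix_apply] <;>
    ring

theorem toMatrix_injective : Function.Injective toMatrix := by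
  intro a b h
  simp only [toMatrix_apply] at h
  have h00 := congrFun (congrFun h 0) 0
  have h01 := congrFun (congrFun h 0) 1
  have h10 := congrFun (congrFun h 1) 0
  have h11 := congrFun (congrFun h 1) 1
  simp at h00 h01 h10 h11
  have hI : Complex.I ≠ 0 := Complex.I_ne_zero
  ext1
  · linear_combination (h00 + h11) / 2
  · apply mul_left_cancel₀ hI
    linear_combination (h00 - h11) / 2
  · linear_combination (h01 - h10) / 2
  · apply mul_left_cancel₀ hI
    linear_combination (h01 + h10) / 2

section Norm

open scoped Matrix.Norms.L2Operator

/-- The C⋆-norm of `𝕄`: the operator norm on `ℂ²` of the representing matrix. -/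
instance instNormedRingM : NormedRing M :=
  NormedRing.induced M (Matrix (Fin 2) (Fin 2) ℂ) toMatrix toMatrix_injective

instance instNormedAlgebraM : NormedAlgebra ℂ M :=
  NormedAlgebra.induced ℂ M (Matrix (Fin 2) (Fin 2) ℂ) toMatrix

end Norm

/-! ### Spectra of quaternions -/

/-- The spectrum of a quaternion, taken in the complex algebra `𝕄`. -/
def qSpectrum (q : ℍ[ℝ]) : Set ℂ := spectrum ℂ (ofQuaternion q)

/-- The set `S_ℍ = {q ∈ ℍ : σ(q) ⊆ S}`. -/
def quatSet (S : Set ℂ) : Set ℍ[ℝ] := {q | qSpectrum q ⊆ S}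

/-- The eigenvalue `s₊(q) = Re q + i ‖Im q‖`. -/
def sPlus (q : ℍ[ℝ]) : ℂ := (q.re : ℂ) + Complex.I * (‖q.im‖ : ℂ)

/-- The eigenvalue `s₋(q) = Re q - i ‖Im q‖`. -/
def sMinus (q : ℍ[ℝ]) : ℂ := (q.re : ℂ) - Complex.I * (‖q.im‖ : ℂ)

/-- The imaginary unit `Im q / ‖Im q‖` of a non-real quaternion (for real `q` it is `0`). -/
def imUnit (q : ℍ[ℝ]) : ℍ[ℝ] := ‖q.im‖⁻¹ • q.im

/-- The element `ι₊(s) = (1 - i s) / 2` of `𝕄`. -/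
def iotaPlus (s : ℍ[ℝ]) : M := (2⁻¹ : ℂ) • (1 - Complex.I • ofQuaternion s)

/-- The element `ι₋(s) = (1 + i s) / 2` of `𝕄`. -/
def iotaMinus (s : ℍ[ℝ]) : M := (2⁻¹ : ℂ) • (1 + Complex.I • ofQuaternion s)

/-- `F_ℍ(q) = F(s₊(q)) ι₊ + F(s₋(q)) ι₋`, with `ι±` taken at `Im q / ‖Im q‖`.  For real `q` this
is `F(q)`; see `FH_coe`. -/
def FH (F : ℂ → M) (q : ℍ[ℝ]) : M :=
  F (sPlus q) * iotaPlus (imUnit q) + F (sMinus q) * iotaMinus (imUnit q)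

theorem FH_coe (F : ℂ → M) (x : ℝ) : FH F (x : ℍ[ℝ]) = F (x : ℂ) := by
  have h : (2⁻¹ : ℂ) • F (x : ℂ) + (2⁻¹ : ℂ) • F (x : ℂ) = F (x : ℂ) := by
    rw [← add_smul]; norm_num
  simpa [FH, sPlus, sMinus, imUnit, iotaPlus, iotaMinus] using h

/-! ### Stem functions -/

/-- A conjugate symmetric subset of the complex plane. -/
def ConjSymmetric (S : Set ℂ) : Prop := ∀ z : ℂ, z ∈ S ↔ starRingEnd ℂ z ∈ S

/-- `F` is an `𝕄`-valued stem function on `U`. -/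
def IsStem (U : Set ℂ) (F : ℂ → M) : Prop := ∀ z ∈ U, F (starRingEnd ℂ z) = conjM (F z)

/-! ### Contour integrals and Cauchy domains -/

/-- `γ`, restricted to `[0, 1]`, is a closed, (continuous and) piecewise `C¹` curve. -/
structure IsPiecewiseSmoothLoop (γ : ℝ → ℂ) : Prop where
  closed : γ 0 = γ 1
  piecewise : ∃ (n : ℕ) (t : ℕ → ℝ), StrictMono t ∧ t 0 = 0 ∧ t n = 1 ∧
    ∀ k < n, ContDiffOn ℝ 1 γ (Set.Icc (t k) (t (k + 1)))

/-- The contour integral `∫_γ G(ζ) dζ` along a curve parametrised by `[0, 1]`. -/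
def contourIntegral {E : Type*} [NormedAddCommGroup E] [NormedSpace ℂ E]
    (γ : ℝ → ℂ) (G : ℂ → E) : E :=
  ∫ t in (0 : ℝ)..1, deriv γ t • G (γ t)

/-- The integral over a finite family of curves. -/
def cycleIntegral {E : Type*} [NormedAddCommGroup E] [NormedSpace ℂ E] {n : ℕ}
    (Γ : Fin n → ℝ → ℂ) (G : ℂ → E) : E :=
  ∑ j, contourIntegral (Γ j) G

/-- The total winding number of a finite family of closed curves about `z`. -/
def windingNumber {n : ℕ} (Γ : Fin n → ℝ → ℂ) (z : ℂ) : ℂ :=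
  (2 * Real.pi * Complex.I)⁻¹ * cycleIntegral Γ (fun ζ => (ζ - z)⁻¹)

/-- A Cauchy domain `Δ` in `U`: a bounded open set with `closure Δ ⊆ U` whose boundary consists of
finitely many piecewise smooth closed curves, positively oriented: the boundary winds once around
each point of `Δ` and does not wind around the points outside `closure Δ`.  Neither `Δ` nor its
boundary has to be connected. -/
structure CauchyDomain (U : Set ℂ) where
  /-- the underlying open set -/
  carrier : Set ℂ
  isOpen : IsOpen carrier
  isBounded : Bornology.IsBounded carrier
  closure_subset : closure carrier ⊆ U
  /-- the number of boundary curves -/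
  n : ℕ
  /-- the boundary curves, parametrised by `[0, 1]` -/
  boundary : Fin n → ℝ → ℂ
  smooth : ∀ j, IsPiecewiseSmoothLoop (boundary j)
  frontier_eq : frontier carrier = ⋃ j, boundary j '' Set.Icc 0 1
  winding_inside : ∀ z ∈ carrier, windingNumber boundary z = 1
  winding_outside : ∀ z ∉ closure carrier, windingNumber boundary z = 0

/-! ### The quaternionic Cauchy transform -/

/-- `(2πi)⁻¹ ∫_Γ F(ζ) (ζ - q)⁻¹ dζ`, where `Γ` is the boundary of the Cauchy domain `D` and the
inverse is taken in `𝕄` (`resolvent a ζ` is the inverse of `ζ - a`). -/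
def cauchyIntegral {U : Set ℂ} (D : CauchyDomain U) (F : ℂ → M) (q : ℍ[ℝ]) : M :=
  (2 * Real.pi * Complex.I : ℂ)⁻¹ •
    cycleIntegral D.boundary (fun ζ => F ζ * resolvent (ofQuaternion q) ζ)

open Classical in
/-- The quaternionic Cauchy transform `C[F]`: the value of `cauchyIntegral` for a Cauchy domain in
`U` that contains the spectrum of `q`. -/
def cauchyTransform (U : Set ℂ) (F : ℂ → M) (q : ℍ[ℝ]) : M :=
  if h : ∃ D : CauchyDomain U, qSpectrum q ⊆ D.carrier then cauchyIntegral h.choose F q else 0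

end QCauchy

end

noncomputable section

namespace QCauchy

open Set Filter Topology MeasureTheory Metric

/-! ### Contour integrals along piecewise smooth loops -/

section Contour

variable {E : Type*} [NormedAddCommGroup E] [NormedSpace ℂ E] {γ : ℝ → ℂ}

/-! For non-real `q` the elements `ι₊`, `ι₋` are complementary idempotents and `q = s₊ι₊ + s₋ι₋`, so
the resolvent splits as `(ζ - s₊)⁻¹ι₊ + (ζ - s₋)⁻¹ι₋` (`resolvent_ofQuaternion`; the formula
persists for real `q`, where `ι₊ = ι₋ = 1/2`). The Cauchy integral thus becomes two ordinary ones,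
for the holomorphic functions `F ι₊` and `F ι₋` at the points `s₊` and `s₋` of the domain. Cauchy's
formula (`CauchyDomain.cycleIntegral_inv_sub_smul`) evaluates them to `F_ℍ(q)`, which does not
mention the domain. A domain exists because the spectrum is finite: small disjoint discs suffice.

Conjugation of `𝕄` is multiplicative, fixes exactly `ℍ` and exchanges `ι₊` with `ι₋`. For a stem
function it therefore swaps the two terms of `F_ℍ(q)`. Conversely, `x + ys` and `x - ys` have the
same spectrum but exchanged idempotents; that both values are quaternions determines `conjM (F z)`
on each idempotent (`conjM_eq_of_isQuaternion`). -/

theorem IsPiecewiseSmoothLoop.continuousOn (h : IsPiecewiseSmoothLoop γ) :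
    ContinuousOn γ (Icc 0 1) := by
  obtain ⟨n, t, ht, h0, h1, hk⟩ := h.piecewise
  have key : ∀ k ≤ n, ContinuousOn γ (Icc (t 0) (t k)) := by
    intro k
    induction k with
    | zero => intro _; simp
    | succ k ih =>
      intro hkn
      rw [← Icc_union_Icc_eq_Icc (ht.monotone (Nat.zero_le k)) (ht.monotone (Nat.le_succ k))]
      exact (ih (by omega)).union_of_isClosed (hk k (by omega)).continuousOn isClosed_Icc
        isClosed_Icc
  simpa only [h0, h1] using key n le_rfl

/-- At the breakpoints `deriv γ` may be meaningless; inside each piece it agrees with the one-sided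
`derivWithin`, which is continuous up to the endpoints. -/
theorem IsPiecewiseSmoothLoop.intervalIntegrable_deriv (h : IsPiecewiseSmoothLoop γ) :
    IntervalIntegrable (deriv γ) volume 0 1 := by
  obtain ⟨n, t, ht, h0, h1, hk⟩ := h.piecewise
  rw [← h0, ← h1]
  refine IntervalIntegrable.trans_iterate fun k hkn => ?_
  have hlt : t k < t (k + 1) := ht (Nat.lt_succ_self k)
  have hc : ContinuousOn (derivWithin γ (Icc (t k) (t (k + 1)))) (uIcc (t k) (t (k + 1))) := by
    rw [uIcc_of_le hlt.le]
    exact (hk k hkn).continuousOn_derivWithin (uniqueDiffOn_Icc hlt) le_rfl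
  refine hc.intervalIntegrable.congr_uIoo fun x hx => ?_
  rw [uIoo_of_le hlt.le] at hx
  exact derivWithin_of_mem_nhds (Icc_mem_nhds hx.1 hx.2)

theorem IsPiecewiseSmoothLoop.isCompact_image (h : IsPiecewiseSmoothLoop γ) :
    IsCompact (γ '' Icc 0 1) :=
  isCompact_Icc.image_of_continuousOn h.continuousOn

theorem IsPiecewiseSmoothLoop.intervalIntegrable (h : IsPiecewiseSmoothLoop γ) {G : ℂ → E}
    (hG : ContinuousOn G (γ '' Icc 0 1)) :
    IntervalIntegrable (fun t => deriv γ t • G (γ t)) volume 0 1 := by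
  refine h.intervalIntegrable_deriv.smul_continuousOn ?_
  rw [uIcc_of_le zero_le_one]
  exact hG.comp h.continuousOn (mapsTo_image _ _)

theorem contourIntegral_sub (h : IsPiecewiseSmoothLoop γ) {G H : ℂ → E}
    (hG : ContinuousOn G (γ '' Icc 0 1)) (hH : ContinuousOn H (γ '' Icc 0 1)) :
    contourIntegral γ (fun ζ => G ζ - H ζ) = contourIntegral γ G - contourIntegral γ H := by
  simp only [contourIntegral, smul_sub]
  exact intervalIntegral.integral_sub (h.intervalIntegrable hG) (h.intervalIntegrable hH)

theorem contourIntegral_add (h : IsPiecewiseSmoothLoop γ) {G H : ℂ → E}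
    (hG : ContinuousOn G (γ '' Icc 0 1)) (hH : ContinuousOn H (γ '' Icc 0 1)) :
    contourIntegral γ (fun ζ => G ζ + H ζ) = contourIntegral γ G + contourIntegral γ H := by
  simp only [contourIntegral, smul_add]
  exact intervalIntegral.integral_add (h.intervalIntegrable hG) (h.intervalIntegrable hH)

theorem contourIntegral_smul_const [CompleteSpace E] (γ : ℝ → ℂ) (g : ℂ → ℂ) (v : E) :
    contourIntegral γ (fun ζ => g ζ • v) = contourIntegral γ g • v := by
  simp only [contourIntegral, ← smul_assoc]
  exact intervalIntegral.integral_smul_const _ _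

theorem contourIntegral_congr {G H : ℂ → E} (hGH : EqOn G H (γ '' Icc 0 1)) :
    contourIntegral γ G = contourIntegral γ H := by
  refine intervalIntegral.integral_congr fun t ht => ?_
  rw [uIcc_of_le zero_le_one] at ht
  simp only [hGH (mem_image_of_mem γ ht)]

/-- Local boundedness replaces joint continuity: Cauchy's estimate turns it into a bound on the
`z`-derivative, which permits differentiation under the integral. -/
theorem differentiableOn_contourIntegral [CompleteSpace E] (h : IsPiecewiseSmoothLoop γ)
    {V : Set ℂ} (hV : IsOpen V) {G : ℂ → ℂ → E}
    (hc : ∀ z ∈ V, ContinuousOn (G z) (γ '' Icc 0 1))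
    (hd : ∀ ζ ∈ γ '' Icc 0 1, DifferentiableOn ℂ (fun z => G z ζ) V)
    (hb : ∀ z₀ ∈ V, ∃ r > 0, ∃ C : ℝ, ∀ z ∈ ball z₀ r, ∀ ζ ∈ γ '' Icc 0 1, ‖G z ζ‖ ≤ C) :
    DifferentiableOn ℂ (fun z => contourIntegral γ (G z)) V := by
  intro z₀ hz₀
  obtain ⟨r₁, hr₁, C, hC⟩ := hb z₀ hz₀
  obtain ⟨r₂, hr₂, hV₂⟩ := Metric.isOpen_iff.1 hV z₀ hz₀
  -- Discs of radius `r` centred in `ball z₀ r`, needed for Cauchy's estimate, stay in `ball z₀ (2 *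
  -- r)`.
  obtain ⟨r, hr, hrr₁, hrr₂⟩ : ∃ r > 0, 2 * r < r₁ ∧ 2 * r < r₂ :=
    ⟨min r₁ r₂ / 3, by positivity, by linarith [min_le_left r₁ r₂, lt_min hr₁ hr₂],
      by linarith [min_le_right r₁ r₂, lt_min hr₁ hr₂]⟩
  have himg : ∀ t ∈ uIoc (0 : ℝ) 1, γ t ∈ γ '' Icc 0 1 := fun t ht => by
    rw [uIoc_of_le zero_le_one] at ht
    exact mem_image_of_mem γ ⟨ht.1.le, ht.2⟩
  have hder : ∀ t ∈ uIoc (0 : ℝ) 1, ∀ z ∈ ball z₀ r,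
      HasDerivAt (fun z => G z (γ t)) (deriv (fun z => G z (γ t)) z) z := fun t ht z hz =>
    ((hd _ (himg t ht)).differentiableAt
      (hV.mem_nhds (hV₂ (ball_subset_ball (by linarith) hz)))).hasDerivAt
  have hbound : ∀ t ∈ uIoc (0 : ℝ) 1, ∀ z ∈ ball z₀ r,
      ‖deriv (fun z => G z (γ t)) z‖ ≤ C / r := fun t ht z hz => by
    have hsub : closedBall z r ⊆ ball z₀ (2 * r) := fun w hw => by
      rw [mem_closedBall] at hw
      rw [mem_ball] at hz ⊢
      linarith [dist_triangle w z z₀]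
    refine Complex.norm_deriv_le_of_forall_mem_sphere_norm_le hr ?_ fun w hw => ?_
    · refine DifferentiableOn.diffContOnCl ((hd _ (himg t ht)).mono ?_)
      rw [closure_ball z hr.ne']
      exact (hsub.trans (ball_subset_ball hrr₂.le)).trans hV₂
    · exact hC w (ball_subset_ball hrr₁.le (hsub (sphere_subset_closedBall hw))) _ (himg t ht)
  have hmeas : ∀ z ∈ V, AEStronglyMeasurable (fun t => deriv γ t • G z (γ t))
      (volume.restrict (uIoc 0 1)) := fun z hz =>
    (h.intervalIntegrable (hc z hz)).aestronglyMeasurable_restrict_uIoc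
  have hmeas' : AEStronglyMeasurable (fun t => deriv γ t • deriv (fun z => G z (γ t)) z₀)
      (volume.restrict (uIoc 0 1)) := by
    -- The derivative is measurable in `t` as a pointwise limit of difference quotients with steps
    -- `r / (n + 2)`.
    have hseq : Tendsto (fun n : ℕ => ((r / (n + 2) : ℝ) : ℂ)) atTop (𝓝[≠] 0) := by
      refine tendsto_nhdsWithin_iff.2 ⟨?_, Eventually.of_forall fun n => ?_⟩
      · have : Tendsto (fun n : ℕ => r / ((n : ℝ) + 2)) atTop (𝓝 0) :=
          tendsto_const_nhds.div_atTop
            (tendsto_atTop_add_const_right _ _ tendsto_natCast_atTop_atTop)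
        exact Complex.ofReal_zero ▸ (Complex.continuous_ofReal.tendsto 0).comp this
      · have : r / ((n : ℝ) + 2) ≠ 0 := by positivity
        simpa only [mem_compl_iff, mem_singleton_iff, Complex.ofReal_eq_zero] using this
    refine aestronglyMeasurable_of_tendsto_ae atTop
      (f := fun (n : ℕ) t => ((r / (n + 2) : ℝ) : ℂ)⁻¹ •
        (deriv γ t • G (z₀ + ((r / (n + 2) : ℝ) : ℂ)) (γ t) - deriv γ t • G z₀ (γ t)))
      (fun n => ?_) ?_
    · refine ((hmeas _ (hV₂ ?_)).sub (hmeas _ hz₀)).const_smul _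
      have : r / ((n : ℝ) + 2) ≤ r := div_le_self hr.le (by linarith [(n.cast_nonneg : (0:ℝ) ≤ n)])
      have h0 : 0 < r / ((n : ℝ) + 2) := by positivity
      rw [mem_ball, dist_self_add_left, Complex.norm_real, Real.norm_of_nonneg h0.le]
      linarith
    · refine (ae_restrict_iff' measurableSet_uIoc).2 (Eventually.of_forall fun t ht => ?_)
      have := ((hder t ht z₀ (mem_ball_self hr)).tendsto_slope_zero.comp hseq).const_smul
        (deriv γ t)
      refine this.congr fun n => ?_
      simp only [Function.comp, ← smul_sub]
      rw [smul_comm]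
  have := (intervalIntegral.hasDerivAt_integral_of_dominated_loc_of_deriv_le
    (F := fun z t => deriv γ t • G z (γ t))
    (F' := fun z t => deriv γ t • deriv (fun z => G z (γ t)) z)
    (bound := fun t => ‖deriv γ t‖ * (C / r))
    (ball_mem_nhds z₀ hr)
    (eventually_of_mem (hV.mem_nhds hz₀) hmeas)
    (h.intervalIntegrable (hc z₀ hz₀)) hmeas'
    (Eventually.of_forall fun t ht z hz => by
      rw [norm_smul]
      exact mul_le_mul_of_nonneg_left (hbound t ht z hz) (norm_nonneg _))
    (h.intervalIntegrable_deriv.norm.mul_const _)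
    (Eventually.of_forall fun t ht z hz => (hder t ht z hz).const_smul _)).2
  exact this.differentiableAt.differentiableWithinAt

/-- Symmetry transfers holomorphy of the difference quotient to its base point. -/
theorem dslope_comm (F : ℂ → E) (a b : ℂ) : dslope F a b = dslope F b a := by
  rcases eq_or_ne a b with rfl | hab
  · rfl
  · rw [dslope_of_ne _ hab.symm, dslope_of_ne _ hab, slope_comm]

/-- For `ζ` in a disc about `z₀` the mean value inequality applies; for `ζ` outside it, the
denominator is at least `R / 2`. -/
theorem exists_norm_dslope_le [CompleteSpace E] {U K : Set ℂ} (hU : IsOpen U) {F : ℂ → E}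
    (hF : DifferentiableOn ℂ F U) (hK : IsCompact K) (hKU : K ⊆ U) {z₀ : ℂ} (hz₀ : z₀ ∈ U) :
    ∃ r > 0, ∃ C : ℝ, ∀ z ∈ ball z₀ r, ∀ ζ ∈ K, ‖dslope F z ζ‖ ≤ C := by
  obtain ⟨R, hR, hRU⟩ := Metric.nhds_basis_closedBall.mem_iff.1 (hU.mem_nhds hz₀)
  obtain ⟨A, hA⟩ := (isCompact_closedBall z₀ R).exists_bound_of_continuousOn
    (((hF.deriv hU).continuousOn).mono hRU)
  obtain ⟨B, hB⟩ := ((isCompact_closedBall z₀ R).union hK).exists_bound_of_continuousOn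
    (hF.continuousOn.mono (union_subset hRU hKU))
  refine ⟨R / 2, by positivity, max A ((R / 2)⁻¹ * (B + B)), fun z hz ζ hζ => ?_⟩
  have hzR : z ∈ closedBall z₀ R :=
    ball_subset_closedBall (ball_subset_ball (by linarith) hz)
  rcases eq_or_ne ζ z with rfl | hne
  · rw [dslope_same]
    exact (hA _ hzR).trans (le_max_left _ _)
  rw [dslope_of_ne _ hne, slope_def_module, norm_smul, norm_inv]
  have hpos : 0 < ‖ζ - z‖ := norm_pos_iff.2 (sub_ne_zero.2 hne)
  by_cases hζR : ζ ∈ closedBall z₀ R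
  · refine le_trans ?_ (le_max_left _ _)
    rw [inv_mul_le_iff₀ hpos, mul_comm]
    exact (convex_closedBall z₀ R).norm_image_sub_le_of_norm_deriv_le
      (fun x hx => hF.differentiableAt (hU.mem_nhds (hRU hx))) hA hzR hζR
  · refine le_trans ?_ (le_max_right _ _)
    have h1 : R / 2 ≤ ‖ζ - z‖ := by
      rw [← dist_eq_norm]
      rw [mem_closedBall, not_le] at hζR
      rw [mem_ball] at hz
      linarith [dist_triangle ζ z z₀]
    have hn : ‖F ζ - F z‖ ≤ B + B :=
      (norm_sub_le _ _).trans (add_le_add (hB _ (Or.inr hζ)) (hB _ (Or.inl hzR)))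
    gcongr

end Contour

/-! ### Cauchy's formula for Cauchy domains -/

section CauchyFormula

variable {E : Type*} [NormedAddCommGroup E] [NormedSpace ℂ E] {U : Set ℂ}

theorem CauchyDomain.image_subset_frontier (D : CauchyDomain U) (j : Fin D.n) :
    D.boundary j '' Icc 0 1 ⊆ frontier D.carrier := by
  rw [D.frontier_eq]
  exact subset_iUnion (fun j => D.boundary j '' Icc 0 1) j

theorem CauchyDomain.image_subset (D : CauchyDomain U) (j : Fin D.n) :
    D.boundary j '' Icc 0 1 ⊆ U :=
  (D.image_subset_frontier j).trans (frontier_subset_closure.trans D.closure_subset)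

theorem CauchyDomain.disjoint_image (D : CauchyDomain U) (j : Fin D.n) {ζ : ℂ}
    (hζ : ζ ∈ D.boundary j '' Icc 0 1) : ζ ∉ D.carrier := by
  have := D.image_subset_frontier j hζ
  rw [D.isOpen.frontier_eq] at this
  exact this.2

theorem continuousOn_inv_sub_smul {K : Set ℂ} {F : ℂ → E} (hF : ContinuousOn F K) {z : ℂ}
    (hz : z ∉ K) : ContinuousOn (fun ζ => (ζ - z)⁻¹ • F ζ) K := by
  refine ContinuousOn.smul (ContinuousOn.inv₀ (by fun_prop) fun ζ hζ h0 => hz ?_) hF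
  rwa [← sub_eq_zero.1 h0]

theorem cycleIntegral_inv_sub_eq {n : ℕ} (Γ : Fin n → ℝ → ℂ) (z : ℂ) :
    cycleIntegral Γ (fun ζ => (ζ - z)⁻¹) = 2 * Real.pi * Complex.I * windingNumber Γ z := by
  rw [windingNumber, ← mul_assoc, mul_inv_cancel₀ Complex.two_pi_I_ne_zero, one_mul]

theorem cycleIntegral_dslope [CompleteSpace E] {n : ℕ} {Γ : Fin n → ℝ → ℂ}
    (hΓ : ∀ j, IsPiecewiseSmoothLoop (Γ j))
    {F : ℂ → E} (hF : ∀ j, ContinuousOn F (Γ j '' Icc 0 1)) {z : ℂ}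
    (hz : ∀ j, z ∉ Γ j '' Icc 0 1) :
    cycleIntegral Γ (dslope F z) = cycleIntegral Γ (fun ζ => (ζ - z)⁻¹ • F ζ) -
      (2 * Real.pi * Complex.I * windingNumber Γ z) • F z := by
  rw [← cycleIntegral_inv_sub_eq, cycleIntegral, cycleIntegral, cycleIntegral, Finset.sum_smul,
    ← Finset.sum_sub_distrib]
  refine Finset.sum_congr rfl fun j _ => ?_
  rw [← contourIntegral_smul_const, ← contourIntegral_sub (hΓ j)
    (continuousOn_inv_sub_smul (hF j) (hz j))
    (continuousOn_inv_sub_smul continuousOn_const (hz j))]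
  refine contourIntegral_congr fun ζ hζ => ?_
  have hne : ζ ≠ z := fun h => hz j (h ▸ hζ)
  rw [dslope_of_ne _ hne, slope_def_module, smul_sub]

theorem differentiableOn_cauchyKernel [CompleteSpace E] {γ : ℝ → ℂ}
    (hγ : IsPiecewiseSmoothLoop γ) {F : ℂ → E} (hF : ContinuousOn F (γ '' Icc 0 1)) {V : Set ℂ} (hV : IsOpen V)
    (hdisj : ∀ z ∈ V, z ∉ γ '' Icc 0 1) :
    DifferentiableOn ℂ (fun z => contourIntegral γ (fun ζ => (ζ - z)⁻¹ • F ζ)) V := by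
  refine differentiableOn_contourIntegral hγ hV
    (fun z hz => continuousOn_inv_sub_smul hF (hdisj z hz)) (fun ζ hζ z hz => ?_) fun z₀ hz₀ => ?_
  · have hne : ζ - z ≠ 0 := fun h => hdisj z hz (sub_eq_zero.1 h ▸ hζ)
    exact (((differentiableAt_const ζ).sub differentiableAt_id).inv
      hne).smul_const _ |>.differentiableWithinAt
  · obtain ⟨R, hR, hRV⟩ := Metric.isOpen_iff.1 hV z₀ hz₀
    obtain ⟨B, hB⟩ := hγ.isCompact_image.exists_bound_of_continuousOn hF
    refine ⟨R / 2, by positivity, (R / 2)⁻¹ * B, fun z hz ζ hζ => ?_⟩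
    rw [norm_smul, norm_inv]
    have h1 : R / 2 ≤ ‖ζ - z‖ := by
      rw [← dist_eq_norm]
      have : R ≤ dist ζ z₀ := not_lt.1 fun hlt => hdisj ζ (hRV hlt) hζ
      rw [mem_ball] at hz
      linarith [dist_triangle ζ z z₀]
    have := hB ζ hζ
    gcongr

theorem tendsto_cauchyKernel_cocompact {γ : ℝ → ℂ} (hγ : IsPiecewiseSmoothLoop γ) {F : ℂ → E}
    (hF : ContinuousOn F (γ '' Icc 0 1)) :
    Tendsto (fun z => contourIntegral γ (fun ζ => (ζ - z)⁻¹ • F ζ)) (cocompact ℂ) (𝓝 0) := by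
  obtain ⟨B, hB⟩ := hγ.isCompact_image.exists_bound_of_continuousOn hF
  obtain ⟨R, hR⟩ := hγ.isCompact_image.isBounded.subset_closedBall (0 : ℂ)
  have himg : ∀ t ∈ uIoc (0 : ℝ) 1, γ t ∈ γ '' Icc 0 1 := fun t ht => by
    rw [uIoc_of_le zero_le_one] at ht
    exact mem_image_of_mem γ ⟨ht.1.le, ht.2⟩
  have hev : ∀ᶠ z in cocompact ℂ, R + 1 < ‖z‖ :=
    tendsto_norm_cocompact_atTop.eventually (eventually_gt_atTop (R + 1))
  have hle : ∀ z : ℂ, R + 1 < ‖z‖ → ∀ ζ ∈ γ '' Icc 0 1, 1 ≤ ‖ζ - z‖ := fun z hz ζ hζ => by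
    have h1 := hR hζ
    rw [mem_closedBall_zero_iff] at h1
    linarith [norm_sub_norm_le z ζ, norm_sub_rev z ζ]
  -- Dominated convergence along a filter requires countable generation.
  have : (cocompact ℂ).IsCountablyGenerated := by
    rw [← Metric.cobounded_eq_cocompact, ← comap_norm_atTop]
    infer_instance
  have := intervalIntegral.tendsto_integral_filter_of_dominated_convergence
    (l := cocompact ℂ) (μ := volume) (a := 0) (b := 1)
    (F := fun z t => deriv γ t • (γ t - z)⁻¹ • F (γ t)) (f := fun _ => (0 : E))
    (fun t => ‖deriv γ t‖ * B) ?_ ?_ (hγ.intervalIntegrable_deriv.norm.mul_const _) ?_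
  · simpa [contourIntegral] using this
  · filter_upwards [hev] with z hz
    refine (hγ.intervalIntegrable (continuousOn_inv_sub_smul hF
      fun hzγ => ?_)).aestronglyMeasurable_restrict_uIoc
    have := hle z hz z hzγ
    simp at this
    linarith
  · filter_upwards [hev] with z hz
    refine Eventually.of_forall fun t ht => ?_
    rw [norm_smul, norm_smul, norm_inv]
    have h1 := inv_le_one_of_one_le₀ (hle z hz _ (himg t ht))
    have h2 := hB _ (himg t ht)
    have h3 : ‖γ t - z‖⁻¹ * ‖F (γ t)‖ ≤ 1 * B := by gcongr
    rw [one_mul] at h3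
    gcongr
  · refine Eventually.of_forall fun t ht => ?_
    have : Tendsto (fun z : ℂ => (γ t - z)⁻¹) (cocompact ℂ) (𝓝 0) := by
      have hc : Tendsto (fun z : ℂ => γ t - z) (cocompact ℂ) (cocompact ℂ) :=
        (Homeomorph.subLeft (γ t)).isClosedEmbedding.tendsto_cocompact
      exact (tendsto_inv₀_cobounded (α := ℂ)).comp
        (by rwa [← Metric.cobounded_eq_cocompact] at hc ⊢)
    simpa using (this.smul_const (F (γ t))).const_smul (deriv γ t)

/-- Cauchy's integral formula for Cauchy domains, by Dixon's argument: the cycle integral of the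
difference quotients of `F` extends to an entire function which vanishes at infinity. -/
theorem CauchyDomain.cycleIntegral_inv_sub_smul [CompleteSpace E] (hU : IsOpen U)
    (D : CauchyDomain U) {F : ℂ → E}
    (hF : DifferentiableOn ℂ F U) {z : ℂ} (hz : z ∈ D.carrier) :
    cycleIntegral D.boundary (fun ζ => (ζ - z)⁻¹ • F ζ) = (2 * Real.pi * Complex.I : ℂ) • F z := by
  classical
  have hFc : ∀ j, ContinuousOn F (D.boundary j '' Icc 0 1) := fun j =>
    hF.continuousOn.mono (D.image_subset j)
  have hout : ∀ w ∉ closure D.carrier, ∀ j, w ∉ D.boundary j '' Icc 0 1 := fun w hw j hwj =>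
    hw (frontier_subset_closure (D.image_subset_frontier j hwj))
  set k : ℂ → E := fun w => cycleIntegral D.boundary (fun ζ => (ζ - w)⁻¹ • F ζ) with hk
  set g : ℂ → E := fun w => cycleIntegral D.boundary (dslope F w) with hg
  have hk_diff : DifferentiableOn ℂ k (closure D.carrier)ᶜ := by
    simp only [hk, cycleIntegral]
    exact DifferentiableOn.fun_sum fun j _ => differentiableOn_cauchyKernel (D.smooth j) (hFc j)
      isClosed_closure.isOpen_compl fun w hw => hout w hw j
  have hg_diff : DifferentiableOn ℂ g U := by
    simp only [hg, cycleIntegral]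
    refine DifferentiableOn.fun_sum fun j _ => differentiableOn_contourIntegral (D.smooth j) hU
      (fun w hw => ?_) (fun ζ hζ => ?_)
      fun w hw => exists_norm_dslope_le hU hF (D.smooth j).isCompact_image (D.image_subset j) hw
    · exact (((Complex.differentiableOn_dslope (hU.mem_nhds hw)).2 hF).continuousOn).mono
        (D.image_subset j)
    · simp only [fun w => dslope_comm F w ζ]
      exact (Complex.differentiableOn_dslope (hU.mem_nhds (D.image_subset j hζ))).2 hF
  -- The winding number vanishes here, which removes the term `F w` from `g`.
  have hgk : EqOn g k (closure D.carrier)ᶜ := fun w hw => by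
    simp only [hg, hk]
    rw [cycleIntegral_dslope D.smooth hFc (hout w hw), D.winding_outside w hw]
    simp
  -- As `closure D.carrier ⊆ U`, the open sets `U` and `(closure D.carrier)ᶜ` cover the plane; `f`
  -- is `g` on one and `k` on the other, hence entire.
  set f : ℂ → E := fun w => if w ∈ closure D.carrier then g w else k w with hf
  have hfk : EqOn f k (closure D.carrier)ᶜ := fun w hw => if_neg hw
  have hfg : EqOn f g U := fun w _ => by
    by_cases hw : w ∈ closure D.carrier
    · exact if_pos hw
    · rw [hfk hw, hgk hw]
  have hf_diff : Differentiable ℂ f := fun w => by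
    by_cases hw : w ∈ closure D.carrier
    · have hwU := hU.mem_nhds (D.closure_subset hw)
      exact (hg_diff.differentiableAt hwU).congr_of_eventuallyEq (eventually_of_mem hwU hfg)
    · have hwU := isClosed_closure.isOpen_compl.mem_nhds hw
      exact (hk_diff.differentiableAt hwU).congr_of_eventuallyEq (eventually_of_mem hwU hfk)
  have hk_lim : Tendsto k (cocompact ℂ) (𝓝 0) := by
    simp only [hk, cycleIntegral]
    simpa using tendsto_finsetSum Finset.univ fun j _ =>
      tendsto_cauchyKernel_cocompact (D.smooth j) (hFc j)
  have hf_lim : Tendsto f (cocompact ℂ) (𝓝 0) :=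
    hk_lim.congr' (eventually_of_mem D.isBounded.isCompact_closure.compl_mem_cocompact
      fun w hw => (hfk hw).symm)
  -- Liouville: an entire function tending to zero at infinity vanishes.
  have h0 : g z = 0 := by
    rw [← hfg (D.closure_subset (subset_closure hz))]
    exact hf_diff.apply_eq_of_tendsto_cocompact z hf_lim
  simp only [hg] at h0
  rw [cycleIntegral_dslope D.smooth hFc fun j hzj => D.disjoint_image j hzj hz,
    D.winding_inside z hz, mul_one] at h0
  exact sub_eq_zero.1 h0

end CauchyFormula

/-! ### Existence of Cauchy domains -/

section Existence

variable {U : Set ℂ}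

/-- The positively oriented circle, parametrised by `[0, 1]`. -/
def circleLoop (c : ℂ) (r : ℝ) (t : ℝ) : ℂ := circleMap c r (2 * Real.pi * t)

theorem isPiecewiseSmoothLoop_circleLoop (c : ℂ) (r : ℝ) :
    IsPiecewiseSmoothLoop (circleLoop c r) where
  closed := by simpa [circleLoop] using (periodic_circleMap c r 0).symm
  piecewise := by
    refine ⟨1, fun k => k, Nat.strictMono_cast, by simp, by simp, fun k _ => ?_⟩
    exact ((contDiff_circleMap c r).comp (contDiff_const.mul contDiff_id)).contDiffOn

theorem image_circleLoop (c : ℂ) {r : ℝ} (hr : 0 ≤ r) :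
    circleLoop c r '' Icc 0 1 = sphere c r := by
  have : circleLoop c r '' Icc 0 1 = circleMap c r '' Icc 0 (2 * Real.pi) := by
    have h : (fun t : ℝ => 2 * Real.pi * t) '' Icc 0 1 = Icc 0 (2 * Real.pi) := by
      rw [Set.image_mul_left_Icc (by positivity) zero_le_one]
      simp
    rw [← h, image_image]
    rfl
  rw [this]
  refine Subset.antisymm ?_ ?_
  · rintro _ ⟨t, -, rfl⟩
    exact circleMap_mem_sphere c hr t
  · have h2 := image_circleMap_Ioc c r
    rw [abs_of_nonneg hr] at h2
    rw [← h2]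
    exact image_mono Ioc_subset_Icc_self

theorem contourIntegral_circleLoop {E : Type*} [NormedAddCommGroup E] [NormedSpace ℂ E]
    (c : ℂ) (r : ℝ) (G : ℂ → E) : contourIntegral (circleLoop c r) G = ∮ ζ in C(c, r), G ζ := by
  have hd : ∀ t, deriv (circleLoop c r) t
      = (2 * Real.pi : ℝ) • deriv (circleMap c r) (2 * Real.pi * t) := fun t =>
    deriv_comp_mul_left (2 * Real.pi) (circleMap c r) t
  simp only [contourIntegral, hd, smul_assoc, intervalIntegral.integral_smul, circleLoop,
    circleIntegral]
  rw [intervalIntegral.smul_integral_comp_mul_left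
    (fun θ => deriv (circleMap c r) θ • G (circleMap c r θ))]
  simp

theorem circleIntegral_inv_sub_eq_zero {c z : ℂ} {r : ℝ} (hr : 0 ≤ r) (hz : z ∉ closedBall c r) :
    (∮ ζ in C(c, r), (ζ - z)⁻¹) = 0 := by
  have hd : ∀ ζ ∈ closedBall c r, DifferentiableAt ℂ (fun ζ => (ζ - z)⁻¹) ζ := fun ζ hζ =>
    (differentiableAt_id.sub_const z).inv fun h => hz (sub_eq_zero.1 h ▸ hζ)
  exact Complex.circleIntegral_eq_zero_of_differentiable_on_off_countable hr countable_empty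
    (fun ζ hζ => (hd ζ hζ).continuousAt.continuousWithinAt)
    fun ζ hζ => hd ζ (ball_subset_closedBall hζ.1)

/-- The Cauchy domain consisting of finitely many disjoint discs of equal radius. -/
def CauchyDomain.discs {n : ℕ} (c : Fin n → ℂ) {r : ℝ} (hr : 0 < r)
    (hU : ∀ i, closedBall (c i) r ⊆ U)
    (hdisj : ∀ i j, i ≠ j → Disjoint (closedBall (c i) r) (closedBall (c j) r)) :
    CauchyDomain U :=
  have hclosure : closure (⋃ i, ball (c i) r) = ⋃ i, closedBall (c i) r := by
    rw [closure_iUnion_of_finite]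
    simp only [closure_ball _ hr.ne']
  have hwinding : ∀ z, windingNumber (fun i => circleLoop (c i) r) z
      = (2 * Real.pi * Complex.I)⁻¹ * ∑ i, ∮ ζ in C(c i, r), (ζ - z)⁻¹ := fun z => by
    simp only [windingNumber, cycleIntegral, contourIntegral_circleLoop]
  { carrier := ⋃ i, ball (c i) r
    isOpen := isOpen_iUnion fun i => isOpen_ball
    isBounded := (Bornology.isBounded_iUnion).2 fun i => isBounded_ball
    closure_subset := hclosure ▸ iUnion_subset hU
    n := n
    boundary := fun i => circleLoop (c i) r
    smooth := fun i => isPiecewiseSmoothLoop_circleLoop _ _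
    frontier_eq := by
      rw [(isOpen_iUnion fun i => isOpen_ball).frontier_eq, hclosure]
      ext z
      simp only [image_circleLoop _ hr.le, Set.mem_sdiff, mem_iUnion, not_exists]
      constructor
      · rintro ⟨⟨i, hi⟩, h⟩
        exact ⟨i, le_antisymm hi (not_lt.1 (h i))⟩
      · rintro ⟨i, hi⟩
        refine ⟨⟨i, sphere_subset_closedBall hi⟩, fun j hj => ?_⟩
        rcases eq_or_ne i j with rfl | hij
        · exact hj.ne hi
        · exact disjoint_left.1 (hdisj i j hij) (sphere_subset_closedBall hi)
            (ball_subset_closedBall hj)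
    winding_inside := fun z hz => by
      obtain ⟨i, hi⟩ := mem_iUnion.1 hz
      rw [hwinding, Finset.sum_eq_single i, circleIntegral.integral_sub_inv_of_mem_ball hi,
        inv_mul_cancel₀ Complex.two_pi_I_ne_zero]
      · exact fun j _ hji => circleIntegral_inv_sub_eq_zero hr.le
          (disjoint_left.1 (hdisj i j hji.symm) (ball_subset_closedBall hi))
      · simp
    winding_outside := fun z hz => by
      rw [hclosure, mem_iUnion, not_exists] at hz
      rw [hwinding, Finset.sum_eq_zero, mul_zero]
      exact fun i _ => circleIntegral_inv_sub_eq_zero hr.le (hz i) }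

theorem exists_cauchyDomain (hU : IsOpen U) {S : Set ℂ} (hS : S.Finite) (hSU : S ⊆ U) :
    ∃ D : CauchyDomain U, S ⊆ D.carrier := by
  obtain ⟨n, c, hc, rfl⟩ := hS.fin_param
  have h1 : ∀ i, ∀ᶠ r : ℝ in 𝓝[>] 0, closedBall (c i) r ⊆ U := fun i => by
    obtain ⟨R, hR, hRU⟩ :=
      Metric.nhds_basis_closedBall.mem_iff.1 (hU.mem_nhds (hSU (mem_range_self i)))
    filter_upwards [Ioo_mem_nhdsGT hR] with r hr
    exact (closedBall_subset_closedBall hr.2.le).trans hRU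
  have h2 : ∀ i j, ∀ᶠ r : ℝ in 𝓝[>] 0,
      i ≠ j → Disjoint (closedBall (c i) r) (closedBall (c j) r) := fun i j => by
    by_cases hij : i = j
    · simp [hij]
    · have hpos : 0 < dist (c i) (c j) := dist_pos.2 (hc.ne hij)
      filter_upwards [Ioo_mem_nhdsGT (half_pos hpos)] with r hr _
      exact closedBall_disjoint_closedBall (by linarith [hr.2])
  obtain ⟨r, hrU, hrd, hr⟩ := ((eventually_all.2 h1).and ((eventually_all.2 fun i =>
    eventually_all.2 (h2 i)).and self_mem_nhdsWithin)).exists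
  refine ⟨CauchyDomain.discs c hr hrU hrd, ?_⟩
  rintro _ ⟨i, rfl⟩
  exact mem_iUnion.2 ⟨i, mem_ball_self hr⟩

end Existence

/-! ### Spectrum and resolvent of a quaternion -/

section Spectrum

variable (q : ℍ[ℝ])

theorem norm_im_smul_imUnit : ‖q.im‖ • imUnit q = q.im := by
  rcases eq_or_ne ‖q.im‖ 0 with h | h
  · rw [h, zero_smul, norm_eq_zero.1 h]
  · rw [imUnit, smul_inv_smul₀ h]

theorem im_mul_im : q.im * q.im = ((-(‖q.im‖ * ‖q.im‖) : ℝ) : ℍ[ℝ]) := by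
  obtain ⟨x, hx⟩ : ∃ x, x = -(‖q.im‖ * ‖q.im‖) := ⟨_, rfl⟩
  rw [← hx]
  rw [← Quaternion.normSq_eq_norm_mul_self, Quaternion.normSq_def'] at hx
  simp only [Quaternion.re_im, Quaternion.imI_im, Quaternion.imJ_im, Quaternion.imK_im] at hx
  ext
  · simp
    linarith
  all_goals simp [mul_comm]

theorem im_mul_imUnit : q.im * imUnit q = ((-‖q.im‖ : ℝ) : ℍ[ℝ]) := by
  rcases eq_or_ne ‖q.im‖ 0 with h | h
  · simp [norm_eq_zero.1 h]
  · rw [imUnit, mul_smul_comm, im_mul_im, ← Quaternion.coe_smul]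
    congr 1
    simp [h]

theorem ofQuaternion_coe (x : ℝ) : ofQuaternion (x : ℍ[ℝ]) = (x : ℂ) • (1 : M) := by
  ext <;> simp

theorem ofQuaternion_smul (x : ℝ) (p : ℍ[ℝ]) :
    ofQuaternion (x • p) = (x : ℂ) • ofQuaternion p := by
  ext <;> simp

theorem ofQuaternion_eq :
    ofQuaternion q = (q.re : ℂ) • (1 : M) + (‖q.im‖ : ℂ) • ofQuaternion (imUnit q) := by
  rw [← ofQuaternion_smul, norm_im_smul_imUnit, ← ofQuaternion_coe, ← map_add,
    Quaternion.re_add_im]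

/-- The factor `‖q.im‖` keeps the relation `s² = -1` valid for real `q`, where `imUnit q = 0`. -/
theorem norm_im_smul_imUnit_mul_imUnit :
    (‖q.im‖ : ℂ) • (ofQuaternion (imUnit q) * ofQuaternion (imUnit q))
      = (-‖q.im‖ : ℂ) • (1 : M) := by
  rw [← smul_mul_assoc, ← ofQuaternion_smul, norm_im_smul_imUnit, ← map_mul, im_mul_imUnit,
    ofQuaternion_coe, Complex.ofReal_neg]

theorem algebraMap_sub_mul_eq_one {ζ : ℂ} (hp : ζ ≠ sPlus q) (hm : ζ ≠ sMinus q) :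
    (algebraMap ℂ M ζ - ofQuaternion q) * ((ζ - sPlus q)⁻¹ • iotaPlus (imUnit q)
      + (ζ - sMinus q)⁻¹ • iotaMinus (imUnit q)) = 1 ∧
    ((ζ - sPlus q)⁻¹ • iotaPlus (imUnit q)
      + (ζ - sMinus q)⁻¹ • iotaMinus (imUnit q)) * (algebraMap ℂ M ζ - ofQuaternion q) = 1 := by
  have hpc := mul_inv_cancel₀ (sub_ne_zero.2 hp)
  have hmc := mul_inv_cancel₀ (sub_ne_zero.2 hm)
  have he := norm_im_smul_imUnit_mul_imUnit q
  rw [ofQuaternion_eq q, Algebra.algebraMap_eq_smul_one, iotaPlus, iotaMinus]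
  set a := (ζ - sPlus q)⁻¹
  set b := (ζ - sMinus q)⁻¹
  rw [sPlus] at hpc
  rw [sMinus] at hmc
  set e := ofQuaternion (imUnit q)
  generalize (‖q.im‖ : ℂ) = N at *
  generalize (q.re : ℂ) = x at *
  -- After `N e² = -N`, both products reduce to a combination of `1` and `e`; `hA` and `hB` give the
  -- two coefficients, the second up to sign.
  have hA : 2⁻¹ * (ζ - x) * (a + b) - 2⁻¹ * Complex.I * (a - b) * N = 1 := by
    linear_combination 2⁻¹ * hpc + 2⁻¹ * hmc
  have hB : 2⁻¹ * Complex.I * (ζ - x) * (a - b) + 2⁻¹ * N * (a + b) = 0 := by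
    linear_combination 2⁻¹ * Complex.I * (hpc - hmc) + 2⁻¹ * N * (a + b) * Complex.I_mul_I
  constructor <;>
  · simp only [mul_add, add_mul, sub_mul, mul_sub, smul_mul_assoc, mul_smul_comm, one_mul, mul_one,
      smul_add, smul_sub, smul_smul]
    linear_combination (norm := module)
      (2⁻¹ * Complex.I * (a - b) : ℂ) • he + hA • (1 : M) - hB • e

theorem resolvent_ofQuaternion {ζ : ℂ} (hp : ζ ≠ sPlus q) (hm : ζ ≠ sMinus q) :
    resolvent (ofQuaternion q) ζ = (ζ - sPlus q)⁻¹ • iotaPlus (imUnit q)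
      + (ζ - sMinus q)⁻¹ • iotaMinus (imUnit q) := by
  obtain ⟨h1, h2⟩ := algebraMap_sub_mul_eq_one q hp hm
  exact Ring.inverse_unit (⟨_, _, h1, h2⟩ : Mˣ)

/-- The product `(z - q)(z - Re q + Im q) = (z - Re q)² - (Im q)²` vanishes. Were `z - q`
invertible, the second factor would be zero, forcing `z = Re q` and `Im q = 0`, hence `z - q = 0`.
-/
theorem mem_qSpectrum {z : ℂ} (hz : (z - q.re) * (z - q.re) = -(‖q.im‖ * ‖q.im‖ : ℂ)) :
    z ∈ qSpectrum q := by
  intro (hu : IsUnit (algebraMap ℂ M z - ofQuaternion q))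
  have h0 : (algebraMap ℂ M z - ofQuaternion q) *
      (algebraMap ℂ M (z - q.re) + ofQuaternion q.im) = 0 := by
    have hq : ofQuaternion q = algebraMap ℂ M q.re + ofQuaternion q.im := by
      conv_lhs => rw [← Quaternion.re_add_im q, map_add, ofQuaternion_coe,
        ← Algebra.algebraMap_eq_smul_one]
    have hv : ofQuaternion q.im * ofQuaternion q.im = algebraMap ℂ M (-(‖q.im‖ * ‖q.im‖)) := by
      rw [← map_mul, im_mul_im, ofQuaternion_coe, Algebra.algebraMap_eq_smul_one]
      push_cast
      rfl
    have hc := Algebra.commutes (A := M) (z - q.re) (ofQuaternion q.im)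
    rw [hq, ← sub_sub, ← map_sub, sub_mul, mul_add, mul_add, ← map_mul, hz, ← hv, hc]
    abel
  rw [hu.mul_right_eq_zero] at h0
  have hre : z - q.re = 0 := by
    have := congrArg QuaternionAlgebra.re h0
    simpa using this
  have hN : ‖q.im‖ = 0 := by
    rw [hre, zero_mul] at hz
    exact_mod_cast mul_self_eq_zero.1 (neg_eq_zero.1 hz.symm)
  have hq : algebraMap ℂ M z - ofQuaternion q = 0 := by
    rw [ofQuaternion_eq q, hN, sub_eq_zero.1 hre, Algebra.algebraMap_eq_smul_one]
    simp
  rw [hq] at hu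
  exact not_isUnit_zero hu

theorem qSpectrum_eq : qSpectrum q = {sPlus q, sMinus q} := by
  refine Subset.antisymm (fun ζ hζ => ?_) ?_
  · by_contra h
    rw [mem_insert_iff, mem_singleton_iff, not_or] at h
    obtain ⟨h1, h2⟩ := algebraMap_sub_mul_eq_one q h.1 h.2
    exact hζ (⟨_, _, h1, h2⟩ : Mˣ).isUnit
  · have hI := Complex.I_mul_I
    rintro _ (rfl | rfl) <;> apply mem_qSpectrum
    · rw [sPlus]
      linear_combination (‖q.im‖ * ‖q.im‖ : ℂ) * hI
    · rw [sMinus]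
      linear_combination (‖q.im‖ * ‖q.im‖ : ℂ) * hI

end Spectrum

/-! ### The Cauchy transform -/

section Transform

variable {U : Set ℂ}

instance instCompleteSpaceM : CompleteSpace M := FiniteDimensional.complete ℂ M

theorem cauchyIntegral_eq_FH (hU : IsOpen U) {F : ℂ → M} (hF : DifferentiableOn ℂ F U)
    {q : ℍ[ℝ]} (D : CauchyDomain U) (hq : qSpectrum q ⊆ D.carrier) :
    cauchyIntegral D F q = FH F q := by
  rw [qSpectrum_eq] at hq
  have hp : sPlus q ∈ D.carrier := hq (by simp)
  have hm : sMinus q ∈ D.carrier := hq (by simp)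
  have hFp : DifferentiableOn ℂ (fun ζ => F ζ * iotaPlus (imUnit q)) U := hF.mul_const _
  have hFm : DifferentiableOn ℂ (fun ζ => F ζ * iotaMinus (imUnit q)) U := hF.mul_const _
  have hsum : cycleIntegral D.boundary (fun ζ => F ζ * resolvent (ofQuaternion q) ζ)
      = cycleIntegral D.boundary (fun ζ => (ζ - sPlus q)⁻¹ • (F ζ * iotaPlus (imUnit q)))
        + cycleIntegral D.boundary (fun ζ => (ζ - sMinus q)⁻¹ • (F ζ * iotaMinus (imUnit q))) := by
    simp only [cycleIntegral, ← Finset.sum_add_distrib]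
    refine Finset.sum_congr rfl fun j _ => ?_
    rw [← contourIntegral_add (D.smooth j)
      (continuousOn_inv_sub_smul (hFp.continuousOn.mono (D.image_subset j))
        fun h => D.disjoint_image j h hp)
      (continuousOn_inv_sub_smul (hFm.continuousOn.mono (D.image_subset j))
        fun h => D.disjoint_image j h hm)]
    refine contourIntegral_congr fun ζ hζ => ?_
    have hζ' := D.disjoint_image j hζ
    rw [resolvent_ofQuaternion q (ne_of_mem_of_not_mem hp hζ').symm
      (ne_of_mem_of_not_mem hm hζ').symm, mul_add,
      mul_smul_comm, mul_smul_comm]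
  rw [cauchyIntegral, hsum, D.cycleIntegral_inv_sub_smul hU hFp hp,
    D.cycleIntegral_inv_sub_smul hU hFm hm, ← smul_add, inv_smul_smul₀ Complex.two_pi_I_ne_zero,
    FH]

theorem exists_cauchyDomain_qSpectrum (hU : IsOpen U) {q : ℍ[ℝ]} (hq : q ∈ quatSet U) :
    ∃ D : CauchyDomain U, qSpectrum q ⊆ D.carrier :=
  exists_cauchyDomain hU (by rw [qSpectrum_eq]; simp) hq

/-- The arbitrary choice of domain is harmless, since every admissible domain gives the same value.
-/
theorem cauchyTransform_eq_FH (hU : IsOpen U) {F : ℂ → M} (hF : DifferentiableOn ℂ F U)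
    {q : ℍ[ℝ]} (hq : q ∈ quatSet U) : cauchyTransform U F q = FH F q := by
  have h := exists_cauchyDomain_qSpectrum hU hq
  rw [cauchyTransform, dif_pos h]
  exact cauchyIntegral_eq_FH hU hF _ h.choose_spec

end Transform

/-! ### Stem functions -/

section Stem

variable {U : Set ℂ} {F : ℂ → M}

theorem conjM_add (a b : M) : conjM (a + b) = conjM a + conjM b := by
  ext <;> simp [conjM]

theorem conjM_mul (a b : M) : conjM (a * b) = conjM a * conjM b := by
  ext <;> simp [conjM]

theorem conjM_conjM (a : M) : conjM (conjM a) = a := by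
  ext <;> simp [conjM]

theorem isQuaternion_iff {a : M} : IsQuaternion a ↔ conjM a = a := by
  constructor
  · rintro ⟨q, rfl⟩
    ext <;> simp [conjM]
  · intro h
    refine ⟨⟨a.re.re, a.imI.re, a.imJ.re, a.imK.re⟩, ?_⟩
    have hre := fun z : ℂ => Complex.conj_eq_iff_re (z := z)
    ext1
    · exact (hre _).1 (congrArg QuaternionAlgebra.re h)
    · exact (hre _).1 (congrArg QuaternionAlgebra.imI h)
    · exact (hre _).1 (congrArg QuaternionAlgebra.imJ h)
    · exact (hre _).1 (congrArg QuaternionAlgebra.imK h)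

theorem conjM_iotaPlus (s : ℍ[ℝ]) : conjM (iotaPlus s) = iotaMinus s := by
  ext <;> simp [conjM, iotaPlus, iotaMinus, map_ofNat, mul_add]

theorem conjM_iotaMinus (s : ℍ[ℝ]) : conjM (iotaMinus s) = iotaPlus s := by
  rw [← conjM_iotaPlus, conjM_conjM]

theorem conj_sPlus (q : ℍ[ℝ]) : starRingEnd ℂ (sPlus q) = sMinus q := by
  simp [sPlus, sMinus, sub_eq_add_neg]

theorem conjM_FH (F : ℂ → M) (q : ℍ[ℝ]) :
    conjM (FH F q) = conjM (F (sPlus q)) * iotaMinus (imUnit q)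
      + conjM (F (sMinus q)) * iotaPlus (imUnit q) := by
  rw [FH, conjM_add, conjM_mul, conjM_mul, conjM_iotaPlus, conjM_iotaMinus]

theorem IsStem.isQuaternion_FH (hF : IsStem U F) {q : ℍ[ℝ]} (hq : sPlus q ∈ U) :
    IsQuaternion (FH F q) := by
  rw [isQuaternion_iff, conjM_FH, FH, ← conj_sPlus, hF _ hq, conjM_conjM, add_comm]

/-- Replacing `s` by `-s` exchanges the idempotents. Conjugating `h₁` and multiplying by `ι₋` on the
right gives `conjM X * ι₋ = Y * ι₋`; likewise `h₂` and `ι₊` give `conjM X * ι₊ = Y * ι₊`. The sum is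
the claim, as `ι₊ + ι₋ = 1`. -/
theorem conjM_eq_of_isQuaternion {X Y : M} {s : ℍ[ℝ]} (hs : s * s = -1)
    (h₁ : IsQuaternion (X * iotaPlus s + Y * iotaMinus s))
    (h₂ : IsQuaternion (X * iotaPlus (-s) + Y * iotaMinus (-s))) : conjM X = Y := by
  have hswap : iotaPlus (-s) = iotaMinus s ∧ iotaMinus (-s) = iotaPlus s := by
    simp [iotaPlus, iotaMinus, sub_eq_add_neg]
  rw [hswap.1, hswap.2] at h₂
  simp only [isQuaternion_iff, conjM_add, conjM_mul, conjM_iotaPlus, conjM_iotaMinus] at h₁ h₂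
  have he : ofQuaternion s * ofQuaternion s = -1 := by rw [← map_mul, hs, map_neg, map_one]
  have hI := Complex.I_mul_I
  have hpp : iotaPlus s * iotaPlus s = iotaPlus s := by
    simp only [iotaPlus, smul_mul_smul_comm, sub_mul, mul_sub, one_mul, mul_one, he, hI]
    module
  have hmm : iotaMinus s * iotaMinus s = iotaMinus s := by
    simp only [iotaMinus, smul_mul_smul_comm, add_mul, mul_add, one_mul, mul_one, he, hI]
    module
  have hpm : iotaPlus s * iotaMinus s = 0 := by
    simp only [iotaPlus, iotaMinus, smul_mul_smul_comm, sub_mul, mul_add, one_mul, mul_one, he, hI]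
    module
  have hmp : iotaMinus s * iotaPlus s = 0 := by
    simp only [iotaPlus, iotaMinus, smul_mul_smul_comm, add_mul, mul_sub, one_mul, mul_one, he, hI]
    module
  have hsum : iotaPlus s + iotaMinus s = 1 := by
    simp only [iotaPlus, iotaMinus]
    module
  have h₃ := congrArg (· * iotaMinus s) h₁
  have h₄ := congrArg (· * iotaPlus s) h₂
  simp only [add_mul, mul_assoc, hpp, hmm, hpm, hmp, mul_zero, zero_add, add_zero] at h₃ h₄
  rw [← mul_one (conjM X), ← hsum, mul_add, h₃, h₄, ← mul_add, hsum, mul_one]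

theorem exists_imaginary_unit : ∃ s : ℍ[ℝ], s.re = 0 ∧ s * s = -1 ∧ ‖s‖ = 1 := by
  obtain ⟨s, h0, h1, h2, h3⟩ : ∃ s : ℍ[ℝ], s.re = 0 ∧ s.imI = 1 ∧ s.imJ = 0 ∧ s.imK = 0 :=
    ⟨⟨0, 1, 0, 0⟩, rfl, rfl, rfl, rfl⟩
  refine ⟨s, h0, ?_, ?_⟩
  · ext <;> simp [h0, h1, h2, h3]
  · rw [← sq_eq_sq₀ (norm_nonneg _) zero_le_one, sq, ← Quaternion.normSq_eq_norm_mul_self,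
      Quaternion.normSq_def', h0, h1, h2, h3]
    norm_num

theorem isStem_of_isQuaternion_FH (hU : ConjSymmetric U)
    (h : ∀ q ∈ quatSet U, IsQuaternion (FH F q)) : IsStem U F := by
  intro z hz
  have hz' := (hU z).1 hz
  rcases eq_or_ne z.im 0 with him | him
  · have hzre : ((z.re : ℝ) : ℂ) = z := Complex.ext rfl (by simp [him])
    have hmem : ((z.re : ℝ) : ℍ[ℝ]) ∈ quatSet U := by
      change qSpectrum _ ⊆ U
      rw [qSpectrum_eq]
      simp [sPlus, sMinus, hzre, hz]
    have := h _ hmem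
    rw [FH_coe, hzre, isQuaternion_iff] at this
    rw [this, Complex.conj_eq_iff_im.2 him]
  obtain ⟨s, hs, hss, hns⟩ := exists_imaginary_unit
  -- The test quaternion is `z.re + y • ε`; positivity of `y` makes its imaginary unit `ε` rather
  -- than `-ε`.
  have key : ∀ ε : ℍ[ℝ], ε.re = 0 → ‖ε‖ = 1 → ∀ y : ℝ, 0 < y →
      ((z.re : ℂ) + Complex.I * y) ∈ U → ((z.re : ℂ) - Complex.I * y) ∈ U →
      IsQuaternion (F (z.re + Complex.I * y) * iotaPlus ε
        + F (z.re - Complex.I * y) * iotaMinus ε) := by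
    intro ε hε hε1 y hy hp hm
    have him : ((z.re : ℍ[ℝ]) + y • ε).im = y • ε := by
      ext <;> simp [hε]
    have hnorm : ‖((z.re : ℍ[ℝ]) + y • ε).im‖ = y := by
      rw [him, norm_smul, hε1, mul_one, Real.norm_of_nonneg hy.le]
    have hre : ((z.re : ℍ[ℝ]) + y • ε).re = z.re := by simp [hε]
    have hsp : sPlus ((z.re : ℍ[ℝ]) + y • ε) = z.re + Complex.I * y := by
      rw [sPlus, hre, hnorm]
    have hsm : sMinus ((z.re : ℍ[ℝ]) + y • ε) = z.re - Complex.I * y := by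
      rw [sMinus, hre, hnorm]
    have hmem : (z.re : ℍ[ℝ]) + y • ε ∈ quatSet U := by
      change qSpectrum _ ⊆ U
      rw [qSpectrum_eq, hsp, hsm]
      simp [insert_subset_iff, hp, hm]
    have := h _ hmem
    rwa [FH, hsp, hsm, imUnit, hnorm, him, inv_smul_smul₀ hy.ne'] at this
  have hconj : starRingEnd ℂ z = z.re - Complex.I * z.im := by
    apply Complex.ext <;> simp
  have hself : z = z.re + Complex.I * z.im := by
    rw [mul_comm]
    exact (Complex.re_add_im z).symm
  have main : ∀ y : ℝ, 0 < y → ((z.re : ℂ) + Complex.I * y) ∈ U →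
      ((z.re : ℂ) - Complex.I * y) ∈ U →
      conjM (F (z.re + Complex.I * y)) = F (z.re - Complex.I * y) := fun y hy hp hm =>
    conjM_eq_of_isQuaternion hss (key s hs hns y hy hp hm)
      (key (-s) (by simp [hs]) (by rw [norm_neg, hns]) y hy hp hm)
  rw [hconj] at hz' ⊢
  rw [hself] at hz
  conv_rhs => rw [hself]
  -- In the lower half-plane the relation is obtained at the conjugate point and then conjugated.
  rcases him.lt_or_gt with hneg | hpos
  · have := main (-z.im) (neg_pos.2 hneg)
    simp only [Complex.ofReal_neg, mul_neg, sub_neg_eq_add, ← sub_eq_add_neg] at this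
    rw [← this hz' hz, conjM_conjM]
  · exact (main z.im hpos hz hz').symm

end Stem

end QCauchy
end

theorem mainTheorem3 (U : Set ℂ) (hU : IsOpen U) (hUsymm : QCauchy.ConjSymmetric U)
    (F : ℂ → QCauchy.M) (hF : AnalyticOnNhd ℂ F U) :
    ((∀ q ∈ QCauchy.quatSet U, QCauchy.IsQuaternion (QCauchy.cauchyTransform U F q)) ↔
        QCauchy.IsStem U F) ∧
      ∀ q ∈ QCauchy.quatSet U,
        (∃ D : QCauchy.CauchyDomain U, QCauchy.qSpectrum q ⊆ D.carrier) ∧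
        (∀ D : QCauchy.CauchyDomain U, QCauchy.qSpectrum q ⊆ D.carrier →
          QCauchy.cauchyTransform U F q = QCauchy.cauchyIntegral D F q) ∧
        QCauchy.cauchyTransform U F q = QCauchy.FH F q := by
  have hFd := hF.differentiableOn
  have hFH := fun q (hq : q ∈ QCauchy.quatSet U) => QCauchy.cauchyTransform_eq_FH hU hFd hq
  refine ⟨⟨fun h => QCauchy.isStem_of_isQuaternion_FH hUsymm fun q hq => hFH q hq ▸ h q hq,
    fun h q hq => ?_⟩, fun q hq => ⟨QCauchy.exists_cauchyDomain_qSpectrum hU hq,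
      fun D hD => ?_, hFH q hq⟩⟩
  · rw [hFH q hq]
    refine h.isQuaternion_FH (hq ?_)
    simp [QCauchy.qSpectrum_eq]
  · rw [hFH q hq, QCauchy.cauchyIntegral_eq_FH hU hFd D hD]
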